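/- Let $G$ be a finite simple undirected triangle-free graph with vertex set $V$, regarded as a digraph by replacing each edge with two opposite arcs. Definitions. For a digraph $D$ on $V$, let $k(D)$ be the minimum size of a feedback vertex set (a set of vertices meeting every directed cycle), $\alpha(D)$ the maximum size of an acyclic set of vertices (one inducing no directed cycle), and $\mathrm{cp}(D)$ the minimum number of parts in a partition of $V$ into cliques (sets whose distinct vertices are pairwise joined by arcs in both directions). $D$ is *vertex-full* if $\mathrm{cp}(D)=\alpha(D)$. Let $\mu(G)$ be the maximum number of edges in a matching of $G$. An alphabet is a finite set $A$ of size $q\ge 2$. The interaction graph of a coding function $f:A^V\to A^V$ has an arc $(u,v)$ iff $f_v$ depends essentially on $x_u$, i.e. there are $x,y\in A^V$ that differ only in coordinate $u$ and satisfy $f_v(x)\neq f_v(y)$. A linear coding function over a finite commutative ring $R$ is a map $f:R^V\to R^V$ with $f_v(x)=\sum_{u} a_{v,u}x_u$, where the sum is over the in-neighbours $u$ of $v$ in the interaction graph of $f$ and every $a_{v,u}$ is invertible in $R$. Let $g(D,q)$ be $\log_q$ of the maximum number of fixed points of a coding function over an alphabet of size $q$ whose interaction graph is a spanning subgraph of $D$,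 and let $g_L(D,q)$ be the same with the maximum restricted to linear coding functions over commutative rings of order $q$. $D$ is *linearly solvable over alphabets of size $q$* if $g_L(D,q)=g(D,q)=k(D)$. $D$ has a linear solution over $R$ if some linear coding function over $R$, with interaction graph a spanning subgraph of $D$, has $|R|^{k(D)}$ fixed points. A routing function on $D$ over $[q]=\{0,\dots,q-1\}$ is a map $f:[q]^V\to[q]^V$ in which every $f_v$ is either a constant or a non-decreasing function of $x_u$ for a single in-neighbour $u$ of $v$ in $D$. $D$ is *solvable by routing over $[q]$* if some routing function on $D$ over $[q]$ has $q^{k(D)}$ fixed points. Theorem. The following are equivalent: 1. $G$ is linearly solvable over some alphabet, i.e. over alphabets of size $q$ for some $q\ge2$. 2. $G$ is linearly solvable over all alphabets, in either of the following two senses, which are also equivalent to each other: (a) $G$ is linearly solvable over alphabets of size $q$ for every $q\ge2$; (b) $G$ has a linear solution over every finite commutative ring $R\ne 0$. 3. $G$ is solvable by routing, in either of the following two senses, which are also equivalent to each other: (a) over $[q]$ for some $q\ge2$; (b) over $[q]$ for every $q\ge2$. 4. $G$ is vertex-full. 5. $\mu(G)=k(G)$. -/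

import Mathlib

namespace NetworkCoding

/-- The (bidirected) digraph of an undirected graph: each edge gives the arcs in both directions. -/
def toDigraph {V : Type*} (G : SimpleGraph V) : Digraph V := ⟨fun u v => G.Adj u v⟩

/-- `C` is the vertex set of a directed cycle of `D`. The indices live in `Fin (l + 1)`, with cyclic
addition, so `l = 0` is a loop and `l = 1` is a pair of opposite arcs. -/
def IsCycleSet {V : Type*} (D : Digraph V) (C : Set V) : Prop :=
  ∃ (l : ℕ) (p : Fin (l + 1) → V),
    Function.Injective p ∧ (∀ i, D.Adj (p i) (p (i + 1))) ∧ Set.range p = C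

/-- `I` is an acyclic set of `D`: the subgraph induced by `I` has no directed cycle. -/
def IsAcyclicSet {V : Type*} (D : Digraph V) (I : Set V) : Prop :=
  ∀ C ⊆ I, ¬ IsCycleSet D C

/-- A feedback vertex set: the complement of an acyclic set. -/
def IsFeedbackVertexSet {V : Type*} (D : Digraph V) (S : Set V) : Prop :=
  IsAcyclicSet D Sᶜ

/-- `k(D)`: the minimum size of a feedback vertex set (`V` finite). -/
noncomputable def feedbackNum {V : Type*} (D : Digraph V) : ℕ :=
  sInf {m | ∃ S : Set V, IsFeedbackVertexSet D S ∧ S.ncard = m}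

/-- `α(D)`: the maximum size of an acyclic set (`V` finite). -/
noncomputable def acyclicNum {V : Type*} (D : Digraph V) : ℕ :=
  sSup {m | ∃ I : Set V, IsAcyclicSet D I ∧ I.ncard = m}

/-- A clique: any two distinct vertices are joined by arcs in both directions. -/
def IsCliqueSet {V : Type*} (D : Digraph V) (s : Set V) : Prop :=
  s.Pairwise D.Adj

/-- `cp(D)`: the minimum number of parts in a partition of the vertices into cliques. -/
noncomputable def cliquePartitionNum {V : Type*} (D : Digraph V) : ℕ :=
  sInf {m | ∃ P : Set (Set V),
    Setoid.IsPartition P ∧ (∀ s ∈ P, IsCliqueSet D s) ∧ P.ncard = m}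

/-- `D` is vertex-full: `cp(D) = α(D)`. -/
def VertexFull {V : Type*} (D : Digraph V) : Prop :=
  cliquePartitionNum D = acyclicNum D

/-- `μ(G)`: the maximum number of edges in a matching (`V` finite). -/
noncomputable def matchingNum {V : Type*} (G : SimpleGraph V) : ℕ :=
  sSup {m | ∃ M : G.Subgraph, M.IsMatching ∧ M.edgeSet.ncard = m}

/-- The interaction graph of a coding function `f : A^V → A^V`: there is an arc from `u` to `v` iff
`f_v` depends essentially on `x_u`. -/
def interactionGraph {V A : Type*} (f : (V → A) → (V → A)) : Digraph V :=
  ⟨fun u v => ∃ x y : V → A, x u ≠ y u ∧ (∀ w, w ≠ u → x w = y w) ∧ f x v ≠ f y v⟩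

/-- The number of fixed points of `f`. -/
noncomputable def numFix {V A : Type*} (f : (V → A) → (V → A)) : ℕ :=
  Nat.card (Function.fixedPoints f)

/-- The `q`-guessing number `g(D,q)`: the base-`q` logarithm of the maximum number of fixed points
of a coding function over an alphabet of size `q` whose interaction graph is a subgraph of `D`. -/
noncomputable def guessingNum {V : Type*} (D : Digraph V) (q : ℕ) : ℝ :=
  Real.logb q (sSup {m : ℕ | ∃ f : (V → Fin q) → (V → Fin q),
    interactionGraph f ≤ D ∧ numFix f = m} : ℕ)

open Classical in
/-- A linear coding function over a commutative ring `R`: each local function is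
`f_i(x) = ∑ a_{i,u} x_u`, where `u` ranges over the in-neighbours of `i` in the interaction graph
of `f` and all `a_{i,u}` are invertible. -/
def IsLinearCoding {V R : Type*} [Fintype V] [CommRing R] (f : (V → R) → (V → R)) : Prop :=
  ∃ a : V → V → Rˣ, ∀ x i,
    f x i = ∑ u with (interactionGraph f).Adj u i, (a i u : R) * x u

/-- The `q`-linear guessing number `g_L(D,q)`: the maximum of `dim Fix(f) = log_q |Fix(f)|` over the
linear coding functions `f` over commutative rings of order `q` whose interaction graph is a
subgraph of `D`. -/
noncomputable def linearGuessingNum {V : Type*} [Fintype V] (D : Digraph V) (q : ℕ) : ℝ :=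
  Real.logb q (sSup {m : ℕ | ∃ (R : Type) (_ : CommRing R) (f : (V → R) → (V → R)),
    Nat.card R = q ∧ IsLinearCoding f ∧ interactionGraph f ≤ D ∧ numFix f = m} : ℕ)

/-- `D` is linearly solvable over alphabets of size `q`: `g_L(D,q) = g(D,q) = k(D)`. -/
def LinearlySolvable {V : Type*} [Fintype V] (D : Digraph V) (q : ℕ) : Prop :=
  linearGuessingNum D q = guessingNum D q ∧ guessingNum D q = feedbackNum D

/-- `D` has a linear solution over the commutative ring `R`: a linear coding function over `R` whose
interaction graph is a subgraph of `D`, with `|R| ^ k(D)` fixed points. -/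
def HasLinearSolution {V : Type*} [Fintype V] (D : Digraph V) (R : Type*) [CommRing R] : Prop :=
  ∃ f : (V → R) → (V → R), IsLinearCoding f ∧ interactionGraph f ≤ D ∧
    numFix f = Nat.card R ^ feedbackNum D

/-- A routing function on `D` over `[q]`: each local function is a non-decreasing function of the
value at a single in-neighbour (or a constant, for a vertex that uses none of its inputs). -/
def IsRouting {V : Type*} (D : Digraph V) {q : ℕ} (f : (V → Fin q) → (V → Fin q)) : Prop :=
  ∀ v, (∃ u, D.Adj u v ∧ ∃ φ : Fin q → Fin q, Monotone φ ∧ ∀ x, f x v = φ (x u)) ∨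
    ∃ c, ∀ x, f x v = c

/-- `D` is solvable by routing over `[q]`: some routing function has `q ^ k(D)` fixed points. -/
def SolvableByRouting {V : Type*} (D : Digraph V) (q : ℕ) : Prop :=
  ∃ f : (V → Fin q) → (V → Fin q), IsRouting D f ∧ numFix f = q ^ feedbackNum D

end NetworkCoding

/-!
Let `I` be a maximum independent set of `G`. Directed cycles of the bidirected graph exist exactly
where there are edges, so `α = |I|` and `k = |Iᶜ|`. Each condition turns out to be equivalent to the
existence of an injection `g : Iᶜ → I` along edges of `G`, a matching saturating `Iᶜ`
(`SaturatesCompl`).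

* Given `g`, the coding function in which matched vertices copy each other and the others are constant
  (`copyCoding`) has `q ^ |Iᶜ|` fixed points; it is a routing function and it is linear over every
  ring. This is the largest possible number, because a fixed point is determined by its values on the
  feedback vertex set `Iᶜ` (`numFix_le`).
* Conversely, suppose a coding function has `q ^ |Iᶜ|` fixed points. Then every assignment on `Iᶜ`
  extends to a fixed point (`exists_fixed_extension`). If moreover the values of a fixed point on
  `Iᶜ` depend only on its values at neighbours in `I`, then counting assignments on `T ⊆ Iᶜ` gives
  `q ^ |T| ≤ q ^ |N(T) ∩ I|`, and Hall's theorem provides `g` (`saturatesCompl_of_extension`).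
  A routing function cannot read a vertex of `Iᶜ` at another vertex of `Iᶜ`, since those values are
  free. For a linear function, let `t → s` be an arc inside `Iᶜ` and look at the fixed point
  extending the indicator of `t`: as `G` has no triangle, no vertex of `I` relays the value of `t`
  to `s`, so the equation at `s` reads `0 = a s t`, which is impossible for a unit.
* A matching has at most `|Iᶜ|` edges and a clique partition at least `|I|` parts, as `Iᶜ` is a vertex
  cover and a clique meets `I` at most once. In either case equality yields `g`, by injectivity on
  one side and by the absence of triangles on the other, and `g` yields equality.
-/

namespace NetworkCoding

open Function

/-! ### Acyclic sets of a bidirected graph -/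

section Basic

variable {V : Type*}

theorem isAcyclicSet_toDigraph_iff (G : SimpleGraph V) (I : Set V) :
    IsAcyclicSet (toDigraph G) I ↔ ∀ u ∈ I, ∀ v ∈ I, ¬ G.Adj u v := by
  constructor
  · intro h u hu v hv huv
    refine h {u, v} (by rintro x (rfl | rfl) <;> assumption) ⟨1, ![u, v], ?_, ?_, ?_⟩
    · intro i j hij
      fin_cases i <;> fin_cases j <;> simp_all [huv.ne, huv.ne.symm]
    · intro i
      fin_cases i
      · exact huv
      · exact huv.symm
    · simp [Set.pair_comm]
  · rintro h C hC ⟨l, p, -, hadj, rfl⟩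
    exact h _ (hC ⟨0, rfl⟩) _ (hC ⟨0 + 1, rfl⟩) (hadj 0)

/-- There is a maximum independent set, and it realizes both `α` and `k`. -/
theorem exists_maximum_independent [Fintype V] (G : SimpleGraph V) :
    ∃ I : Set V, (∀ u ∈ I, ∀ v ∈ I, ¬ G.Adj u v) ∧
      feedbackNum (toDigraph G) = Nat.card ↥Iᶜ ∧ acyclicNum (toDigraph G) = Nat.card I := by
  have hne : {m | ∃ S : Set V, IsFeedbackVertexSet (toDigraph G) S ∧ S.ncard = m}.Nonempty := by
    refine ⟨_, Set.univ, ?_, rfl⟩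
    rw [IsFeedbackVertexSet, isAcyclicSet_toDigraph_iff]
    simp
  obtain ⟨S, hS, hk⟩ := Nat.sInf_mem hne
  refine ⟨Sᶜ, (isAcyclicSet_toDigraph_iff G _).1 hS, ?_, ?_⟩
  · rw [compl_compl]
    exact hk.symm
  · refine IsGreatest.csSup_eq ⟨⟨Sᶜ, hS, rfl⟩, ?_⟩
    rintro m ⟨J, hJ, rfl⟩
    have h1 : S.ncard ≤ Jᶜ.ncard := by
      rw [hk]
      exact Nat.sInf_le ⟨Jᶜ, by rwa [IsFeedbackVertexSet, compl_compl], rfl⟩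
    have h2 := Set.ncard_add_ncard_compl J
    have h3 := Set.ncard_add_ncard_compl S
    have h4 : Nat.card ↥Sᶜ = Sᶜ.ncard := rfl
    omega

/-- The complement of `I` is saturated by a matching of `G` between `Iᶜ` and `I`. -/
def SaturatesCompl (G : SimpleGraph V) (I : Set V) : Prop :=
  ∃ g : ↥Iᶜ → V, Injective g ∧ ∀ s, g s ∈ I ∧ G.Adj s (g s)

end Basic

/-! ### Fixed points of coding functions -/

section FixedPoints

variable {V A : Type*} {G : SimpleGraph V} {I : Set V}

/-- A local function depends only on the values at the in-neighbours in the interaction graph. -/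
theorem apply_eq_of_eq_on_adj [Fintype V] {D : Digraph V} {f : (V → A) → (V → A)}
    (hf : interactionGraph f ≤ D) {x y : V → A} {v : V} (h : ∀ u, D.Adj u v → x u = y u) :
    f x v = f y v := by
  classical
  -- Replace the values of `x` by those of `y` one coordinate at a time.
  have key : ∀ T : Finset V, f (T.piecewise y x) v = f x v := by
    intro T
    induction T using Finset.induction_on with
    | empty => simp
    | insert u T hu ih =>
      rw [← ih]
      by_contra hne
      have hxy : x u ≠ y u := by
        intro hxy
        apply hne
        congr 1
        rw [Finset.piecewise_insert, ← hxy]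
        refine update_eq_self_iff.2 ?_
        simp [hu]
      refine hxy (h u (hf ⟨(insert u T).piecewise y x, T.piecewise y x, ?_, ?_, hne⟩))
      · simpa [hu] using hxy.symm
      · intro w hw
        rw [Finset.piecewise_insert, update_of_ne hw]
  have := key Finset.univ
  rw [Finset.piecewise_univ] at this
  exact this.symm

/-- A fixed point is determined by its restriction to the complement of an independent set. -/
theorem restrict_fixedPoints_injective [Fintype V] (hI : ∀ u ∈ I, ∀ v ∈ I, ¬ G.Adj u v)
    {f : (V → A) → (V → A)} (hf : interactionGraph f ≤ toDigraph G) :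
    Injective (fun (x : fixedPoints f) (s : ↥Iᶜ) => (x : V → A) s) := by
  rintro ⟨x, hx⟩ ⟨y, hy⟩ hxy
  have hS : ∀ v, v ∉ I → x v = y v := fun v hv => congrFun hxy ⟨v, hv⟩
  refine Subtype.ext (funext fun v => ?_)
  by_cases hv : v ∈ I
  · change x v = y v
    rw [← congrFun hx.eq v, ← congrFun hy.eq v]
    exact apply_eq_of_eq_on_adj hf fun u hu => hS u fun huI => hI u huI v hv hu
  · exact hS v hv

theorem numFix_le [Fintype V] [Finite A] (hI : ∀ u ∈ I, ∀ v ∈ I, ¬ G.Adj u v)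
    {f : (V → A) → (V → A)} (hf : interactionGraph f ≤ toDigraph G) :
    numFix f ≤ Nat.card A ^ Nat.card ↥Iᶜ := by
  rw [← Nat.card_fun]
  exact Nat.card_le_card_of_injective _ (restrict_fixedPoints_injective hI hf)

/-- Restriction to `Iᶜ` is an injection of the fixed points into the assignments on `Iᶜ`, so it is
bijective when there are equally many of both. -/
theorem exists_fixed_extension [Fintype V] [Finite A] (hI : ∀ u ∈ I, ∀ v ∈ I, ¬ G.Adj u v)
    {f : (V → A) → (V → A)} (hf : interactionGraph f ≤ toDigraph G)
    (hfix : numFix f = Nat.card A ^ Nat.card ↥Iᶜ) (y : V → A) :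
    ∃ x : V → A, f x = x ∧ ∀ s, s ∉ I → x s = y s := by
  have hb := (restrict_fixedPoints_injective hI hf).bijective_of_nat_card_le
    (by rw [Nat.card_fun]; exact hfix.ge)
  obtain ⟨⟨x, hx⟩, hxy⟩ := hb.2 (fun s => y s)
  exact ⟨x, hx, fun s hs => congrFun hxy ⟨s, hs⟩⟩

/-- If a set of assignments realizes every assignment on `Iᶜ`, and the value of each of its members
at a vertex of `Iᶜ` is determined by the values at the neighbours in `I`, then Hall's condition
holds for the edges between `Iᶜ` and `I`. -/
theorem saturatesCompl_of_extension [Fintype V] [Finite A] [Nontrivial A] {X : Set (V → A)}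
    (hext : ∀ y : V → A, ∃ x ∈ X, ∀ s, s ∉ I → x s = y s)
    (hdet : ∀ x ∈ X, ∀ y ∈ X, ∀ s, s ∉ I → (∀ u ∈ I, G.Adj s u → x u = y u) → x s = y s) :
    SaturatesCompl G I := by
  classical
  have hall := (Finset.all_card_le_biUnion_card_iff_exists_injective
    (fun s : ↥Iᶜ => Finset.univ.filter fun u : V => u ∈ I ∧ G.Adj s u)).1 ?_
  · obtain ⟨g, hg, hmem⟩ := hall
    exact ⟨g, hg, fun s => by simpa using hmem s⟩
  intro T
  set N := T.biUnion (fun s : ↥Iᶜ => Finset.univ.filter fun u : V => u ∈ I ∧ G.Adj s u)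
  choose e heX he using hext
  obtain ⟨a⟩ : Nonempty A := inferInstance
  let E : (T → A) → V → A := fun y =>
    e fun v => if h : ∃ hv : v ∈ Iᶜ, (⟨v, hv⟩ : ↥Iᶜ) ∈ T then y ⟨⟨v, h.1⟩, h.2⟩ else a
  have hE : ∀ y (t : T), E y t.1 = y t := by
    intro y t
    have : ∃ hv : t.1.1 ∈ Iᶜ, (⟨t.1.1, hv⟩ : ↥Iᶜ) ∈ T := ⟨t.1.2, t.2⟩
    exact (he _ _ t.1.2).trans (dif_pos this)
  have hinj : Injective fun (y : T → A) (n : N) => E y n := by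
    intro y z hyz
    funext t
    rw [← hE y t, ← hE z t]
    refine hdet _ (heX _) _ (heX _) _ t.1.2 fun u hu hadj => ?_
    exact congrFun hyz ⟨u, Finset.mem_biUnion.2 ⟨t.1, t.2, by simp [hu, hadj]⟩⟩
  have hcard := Nat.card_le_card_of_injective _ hinj
  rw [Nat.card_fun, Nat.card_fun, Nat.card_eq_fintype_card (α := T),
    Nat.card_eq_fintype_card (α := N), Fintype.card_coe, Fintype.card_coe] at hcard
  exact (Nat.pow_le_pow_iff_right Finite.one_lt_card).1 hcard

/-! ### From a routing or linear solution to a matching -/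

theorem IsRouting.interactionGraph_le {D : Digraph V} {q : ℕ}
    {f : (V → Fin q) → (V → Fin q)} (hf : IsRouting D f) : interactionGraph f ≤ D := by
  rintro u v ⟨x, y, -, hxy, hne⟩
  rcases hf v with ⟨w, hw, φ, -, hφ⟩ | ⟨c, hc⟩
  · by_cases hwu : w = u
    · exact hwu ▸ hw
    · exact absurd (by rw [hφ, hφ, hxy w hwu]) hne
  · exact absurd (by rw [hc, hc]) hne

theorem saturatesCompl_of_routing [Fintype V] {q : ℕ} (hq : 2 ≤ q)
    (hI : ∀ u ∈ I, ∀ v ∈ I, ¬ G.Adj u v)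
    {f : (V → Fin q) → (V → Fin q)} (hf : IsRouting (toDigraph G) f)
    (hfix : numFix f = q ^ Nat.card ↥Iᶜ) : SaturatesCompl G I := by
  classical
  have : Nontrivial (Fin q) := Fin.nontrivial_iff_two_le.2 hq
  have hext := exists_fixed_extension hI hf.interactionGraph_le (by simpa using hfix)
  refine saturatesCompl_of_extension (X := {x | f x = x}) hext ?_
  intro x (hx : f x = x) y (hy : f y = y) s hs hxy
  rcases hf s with ⟨u, hu, φ, -, hφ⟩ | ⟨c, hc⟩
  · by_cases huI : u ∈ I
    · rw [← congrFun hx s, ← congrFun hy s, hφ, hφ, hxy u huI hu.symm]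
    · -- Both values at `s` would be functions of the value at `u`, but the two are independent.
      obtain ⟨a, b, hab⟩ := exists_pair_ne (Fin q)
      obtain ⟨z, hz, hz'⟩ := hext fun _ => a
      obtain ⟨w, hw, hw'⟩ := hext fun v => if v = s then b else a
      have hus : u ≠ s := SimpleGraph.Adj.ne hu
      refine absurd ?_ hab
      calc a = f z s := by rw [hz, hz' s hs]
        _ = f w s := by rw [hφ, hφ, hz' u huI, hw' u huI, if_neg hus]
        _ = b := by rw [hw, hw' s hs, if_pos rfl]
  · rw [← congrFun hx s, ← congrFun hy s, hc, hc]

theorem saturatesCompl_of_linear [Fintype V] {R : Type*} [CommRing R] [Finite R] [Nontrivial R]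
    (hG : G.CliqueFree 3) (hI : ∀ u ∈ I, ∀ v ∈ I, ¬ G.Adj u v)
    {f : (V → R) → (V → R)} (hlin : IsLinearCoding f) (hf : interactionGraph f ≤ toDigraph G)
    (hfix : numFix f = Nat.card R ^ Nat.card ↥Iᶜ) : SaturatesCompl G I := by
  classical
  have hext := exists_fixed_extension hI hf hfix
  obtain ⟨a, ha⟩ := hlin
  have noArc : ∀ s, s ∉ I → ∀ t, t ∉ I → ¬ (interactionGraph f).Adj t s := by
    intro s hs t ht hts
    have hGts : G.Adj t s := hf hts
    obtain ⟨x, hx, hx'⟩ := hext (Pi.single t 1)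
    have hxs : x s = 0 := by rw [hx' s hs, Pi.single_eq_of_ne hGts.ne.symm]
    -- In the linear equation at `s`, only the summand of `t` survives.
    have hsum : x s = a s t := by
      conv_lhs => rw [← hx]
      rw [ha, Finset.sum_eq_single t]
      · rw [hx' t ht, Pi.single_eq_same, mul_one]
      · intro u hu hut
        have hus : G.Adj u s := hf (Finset.mem_filter.1 hu).2
        by_cases huI : u ∈ I
        · rw [← hx, ha, Finset.sum_eq_zero, mul_zero]
          intro w hw
          have hwu : G.Adj w u := hf (Finset.mem_filter.1 hw).2
          have hwI : w ∉ I := fun hwI => hI w hwI u huI hwu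
          have hwt : w ≠ t := by
            rintro rfl
            exact hG {w, u, s} (SimpleGraph.is3Clique_triple_iff.2 ⟨hwu, hGts, hus⟩)
          rw [hx' w hwI, Pi.single_eq_of_ne hwt, mul_zero]
        · rw [hx' u huI, Pi.single_eq_of_ne hut, mul_zero]
      · intro h
        exact absurd (Finset.mem_filter.2 ⟨Finset.mem_univ t, hts⟩) h
    exact (a s t).ne_zero (hsum.symm.trans hxs)
  refine saturatesCompl_of_extension (X := {x | f x = x}) hext ?_
  intro x (hx : f x = x) y (hy : f y = y) s hs hxy
  rw [← congrFun hx s, ← congrFun hy s, ha, ha]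
  refine Finset.sum_congr rfl fun u hu => ?_
  have hus := (Finset.mem_filter.1 hu).2
  rw [hxy u (by_contra fun h => noArc s hs u h hus) (hf hus : G.Adj u s).symm]

/-! ### The coding function of a matching -/

/-- The coding function in which the vertex `v` copies the value of `h v`, if there is one, and takes
the constant value `c` otherwise. -/
def copyCoding (h : V → Option V) (c : A) (x : V → A) (v : V) : A := (h v).elim c x

theorem interactionGraph_copyCoding [Nontrivial A] (h : V → Option V) (c : A) (u v : V) :
    (interactionGraph (copyCoding h c)).Adj u v ↔ h v = some u := by
  classical
  constructor
  · rintro ⟨x, y, -, hxy, hne⟩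
    cases hv : h v with
    | none => simp [copyCoding, hv] at hne
    | some w =>
      by_contra hw
      exact hne (by simpa [copyCoding, hv] using hxy w fun h => hw (h ▸ rfl))
  · intro hv
    obtain ⟨a, b, hab⟩ := exists_pair_ne A
    refine ⟨fun _ => a, update (fun _ => a) u b, ?_, ?_, ?_⟩
    · simpa using hab
    · intro w hw
      rw [update_of_ne hw]
    · simpa [copyCoding, hv] using hab

/-- A matching saturating `Iᶜ` gives a partial involution of the vertices along edges whose coding
function has the maximum possible number of fixed points, over every alphabet. -/
theorem SaturatesCompl.exists_copyCoding [Fintype V] (hI : ∀ u ∈ I, ∀ v ∈ I, ¬ G.Adj u v)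
    (hs : SaturatesCompl G I) :
    ∃ h : V → Option V, (∀ u v, h v = some u → G.Adj u v) ∧
      ∀ (B : Type) [Finite B] [Nontrivial B] (c : B),
        numFix (copyCoding h c) = Nat.card B ^ Nat.card ↥Iᶜ := by
  classical
  obtain ⟨g, hg, hadj⟩ := hs
  let h : V → Option V := fun v =>
    if hv : v ∈ Iᶜ then some (g ⟨v, hv⟩) else
      if hv : ∃ s, g s = v then some (hv.choose : V) else none
  have h1 : ∀ s : ↥Iᶜ, h s = some (g s) := fun s => dif_pos s.2
  have h2 : ∀ s : ↥Iᶜ, h (g s) = some (s : V) := by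
    intro s
    have hex : ∃ s', g s' = g s := ⟨s, rfl⟩
    have : h (g s) = some (hex.choose : V) :=
      (dif_neg (not_not.2 (hadj s).1)).trans (dif_pos hex)
    rw [this, hg hex.choose_spec]
  have h3 : ∀ v, v ∈ I → (∀ s, g s ≠ v) → h v = none := fun v hv hn =>
    (dif_neg (not_not.2 hv)).trans (dif_neg (not_exists.2 hn))
  have hG : ∀ u v, h v = some u → G.Adj u v := by
    intro u v huv
    by_cases hv : v ∈ I
    · by_cases hex : ∃ s, g s = v
      · obtain ⟨s, rfl⟩ := hex
        rw [h2] at huv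
        exact Option.some.inj huv ▸ (hadj s).2
      · rw [h3 v hv (not_exists.1 hex)] at huv
        exact absurd huv (by simp)
    · rw [h1 ⟨v, hv⟩] at huv
      exact Option.some.inj huv ▸ (hadj ⟨v, hv⟩).2.symm
  refine ⟨h, hG, fun B _ _ c => le_antisymm (numFix_le hI ?_) ?_⟩
  · intro u v huv
    exact hG u v ((interactionGraph_copyCoding h c u v).1 huv)
  · -- Copying an assignment on `Iᶜ` along the matching gives a fixed point.
    let E : (↥Iᶜ → B) → V → B := fun y v =>
      if hv : v ∈ Iᶜ then y ⟨v, hv⟩ else if hv : ∃ s, g s = v then y hv.choose else c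
    have e1 : ∀ y (s : ↥Iᶜ), E y s = y s := fun y s => dif_pos s.2
    have e2 : ∀ y (s : ↥Iᶜ), E y (g s) = y s := by
      intro y s
      have hex : ∃ s', g s' = g s := ⟨s, rfl⟩
      have : E y (g s) = y hex.choose :=
        (dif_neg (not_not.2 (hadj s).1)).trans (dif_pos hex)
      rw [this, hg hex.choose_spec]
    have e3 : ∀ y v, v ∈ I → (∀ s, g s ≠ v) → E y v = c := fun y v hv hn =>
      (dif_neg (not_not.2 hv)).trans (dif_neg (not_exists.2 hn))
    have hE : ∀ y, copyCoding h c (E y) = E y := by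
      intro y
      funext v
      by_cases hv : v ∈ I
      · by_cases hex : ∃ s, g s = v
        · obtain ⟨s, rfl⟩ := hex
          rw [copyCoding, h2, e2, Option.elim_some, e1]
        · rw [copyCoding, h3 v hv (not_exists.1 hex), e3 y v hv (not_exists.1 hex),
            Option.elim_none]
      · rw [copyCoding, h1 ⟨v, hv⟩, Option.elim_some, e2, e1 y ⟨v, hv⟩]
    rw [← Nat.card_fun]
    refine Nat.card_le_card_of_injective
      (fun y => (⟨E y, hE y⟩ : fixedPoints (copyCoding h c))) fun y z hyz => ?_
    funext s
    rw [← e1 y s, ← e1 z s]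
    exact congrFun (congrArg Subtype.val hyz) s

theorem isLinearCoding_copyCoding [Fintype V] {R : Type*} [CommRing R] [Nontrivial R]
    (h : V → Option V) :
    IsLinearCoding (copyCoding h (0 : R)) := by
  classical
  refine ⟨fun _ _ => 1, fun x v => ?_⟩
  simp only [interactionGraph_copyCoding, Units.val_one, one_mul]
  cases hv : h v with
  | none => simp [copyCoding, hv]
  | some u => simp [copyCoding, hv, Finset.filter_eq]

theorem isRouting_copyCoding {q : ℕ} {h : V → Option V} (hG : ∀ u v, h v = some u → G.Adj u v)
    (c : Fin q) : IsRouting (toDigraph G) (copyCoding h c) := by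
  intro v
  cases hv : h v with
  | none => exact Or.inr ⟨c, fun x => by simp [copyCoding, hv]⟩
  | some u =>
    exact Or.inl ⟨u, hG u v hv, id, monotone_id, fun x => by simp [copyCoding, hv]⟩

theorem interactionGraph_copyCoding_le [Nontrivial A] {h : V → Option V}
    (hG : ∀ u v, h v = some u → G.Adj u v) (c : A) :
    interactionGraph (copyCoding h c) ≤ toDigraph G := fun u v huv =>
  hG u v ((interactionGraph_copyCoding h c u v).1 huv)

end FixedPoints

/-! ### Matchings -/

section Matching

variable {V : Type*} {G : SimpleGraph V} {I : Set V}

theorem eq_of_mem_edgeSet_of_isMatching {M : G.Subgraph} (hM : M.IsMatching) {e e' : Sym2 V}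
    (he : e ∈ M.edgeSet) (he' : e' ∈ M.edgeSet) {v : V} (hv : v ∈ e) (hv' : v ∈ e') : e = e' := by
  obtain ⟨w, rfl⟩ := hv
  obtain ⟨w', rfl⟩ := hv'
  rw [SimpleGraph.Subgraph.mem_edgeSet] at he he'
  rw [(hM (M.edge_vert he)).unique he he']

/-- Distinct edges of a matching contain distinct vertices of the vertex cover `Iᶜ`. -/
theorem exists_injective_edgeSet_compl (hI : ∀ u ∈ I, ∀ v ∈ I, ¬ G.Adj u v) {M : G.Subgraph}
    (hM : M.IsMatching) : ∃ c : M.edgeSet → ↥Iᶜ, Injective c ∧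
      ∀ e : M.edgeSet, (c e : V) ∈ (e : Sym2 V) := by
  have : ∀ e : M.edgeSet, ∃ s : ↥Iᶜ, (s : V) ∈ (e : Sym2 V) := by
    rintro ⟨e, he⟩
    induction e using Sym2.ind with
    | _ u v =>
      by_cases hu : u ∈ I
      · exact ⟨⟨v, fun hv => hI u hu v hv (M.adj_sub he)⟩, Sym2.mem_mk_right u v⟩
      · exact ⟨⟨u, hu⟩, Sym2.mem_mk_left u v⟩
  choose c hc using this
  refine ⟨c, fun e e' hee => Subtype.ext ?_, hc⟩
  exact eq_of_mem_edgeSet_of_isMatching hM e.2 e'.2 (hc e) (hee ▸ hc e')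

theorem ncard_edgeSet_le [Fintype V] (hI : ∀ u ∈ I, ∀ v ∈ I, ¬ G.Adj u v) {M : G.Subgraph}
    (hM : M.IsMatching) : M.edgeSet.ncard ≤ Nat.card ↥Iᶜ := by
  obtain ⟨c, hc, -⟩ := exists_injective_edgeSet_compl hI hM
  exact Nat.card_le_card_of_injective c hc

/-- If a matching has as many edges as the vertex cover `Iᶜ` has vertices, then each edge contains
exactly one vertex of `Iᶜ`. -/
theorem saturatesCompl_of_isMatching [Fintype V]
    (hI : ∀ u ∈ I, ∀ v ∈ I, ¬ G.Adj u v) {M : G.Subgraph}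
    (hM : M.IsMatching) (hcard : M.edgeSet.ncard = Nat.card ↥Iᶜ) : SaturatesCompl G I := by
  obtain ⟨c, hc, hmem⟩ := exists_injective_edgeSet_compl hI hM
  have hsurj := (hc.bijective_of_nat_card_le hcard.ge).2
  choose d hd using hsurj
  have hmem' : ∀ s : ↥Iᶜ, ∃ v, s(↑s, v) = (d s : Sym2 V) := by
    intro s
    have := hmem (d s)
    rw [hd] at this
    obtain ⟨v, hv⟩ := this
    exact ⟨v, hv.symm⟩
  choose g hg using hmem'
  have hadj : ∀ s : ↥Iᶜ, G.Adj s (g s) := fun s =>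
    M.adj_sub (SimpleGraph.Subgraph.mem_edgeSet.1 (hg s ▸ (d s).2))
  have hgm : ∀ s, g s ∈ (d s : Sym2 V) := fun s => hg s ▸ Sym2.mem_mk_right _ _
  refine ⟨g, fun s t hst => ?_, fun s => ⟨?_, hadj s⟩⟩
  · have : d s = d t := Subtype.ext
      (eq_of_mem_edgeSet_of_isMatching hM (d s).2 (d t).2 (hgm s) (hst ▸ hgm t))
    rw [← hd s, ← hd t, this]
  · by_contra hgs
    -- Otherwise `g s` is the representative in `Iᶜ` of an edge, which can only be the edge of `s`.
    have hm := hmem (d ⟨g s, hgs⟩)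
    rw [hd] at hm
    have : d ⟨g s, hgs⟩ = d s := Subtype.ext
      (eq_of_mem_edgeSet_of_isMatching hM (d _).2 (d s).2 hm (hgm s))
    have h2 : (⟨g s, hgs⟩ : ↥Iᶜ) = s := by rw [← hd ⟨g s, hgs⟩, this, hd]
    exact (hadj s).ne (congrArg Subtype.val h2).symm

theorem SaturatesCompl.exists_isMatching (hs : SaturatesCompl G I) :
    ∃ M : G.Subgraph, M.IsMatching ∧ M.edgeSet.ncard = Nat.card ↥Iᶜ := by
  obtain ⟨g, hg, hadj⟩ := hs
  let M : G.Subgraph :=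
    { verts := {v | v ∈ Iᶜ ∨ ∃ s, g s = v}
      Adj := fun u v => ∃ s : ↥Iᶜ, (u = s ∧ v = g s) ∨ (u = g s ∧ v = s)
      adj_sub := by
        rintro u v ⟨s, ⟨rfl, rfl⟩ | ⟨rfl, rfl⟩⟩
        exacts [(hadj s).2, (hadj s).2.symm]
      edge_vert := by
        rintro u v ⟨s, ⟨rfl, rfl⟩ | ⟨rfl, rfl⟩⟩
        exacts [Or.inl s.2, Or.inr ⟨s, rfl⟩]
      symm := ⟨by
        rintro u v ⟨s, h | h⟩
        exacts [⟨s, Or.inr h.symm⟩, ⟨s, Or.inl h.symm⟩]⟩ }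
  refine ⟨M, ?_, ?_⟩
  · have hne : ∀ s t : ↥Iᶜ, (s : V) ≠ g t := fun s t h => s.2 (h ▸ (hadj t).1)
    rintro v (hv | ⟨s, rfl⟩)
    · refine ⟨g ⟨v, hv⟩, ⟨⟨v, hv⟩, Or.inl ⟨rfl, rfl⟩⟩, ?_⟩
      rintro w ⟨t, ⟨rfl, rfl⟩ | ⟨h, rfl⟩⟩
      · rfl
      · exact absurd h (hne ⟨v, hv⟩ t)
    · refine ⟨s, ⟨s, Or.inr ⟨rfl, rfl⟩⟩, ?_⟩
      rintro w ⟨t, ⟨h, rfl⟩ | ⟨h, rfl⟩⟩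
      · exact absurd h.symm (hne t s)
      · rw [hg h]
  · have hrange : M.edgeSet = Set.range fun s : ↥Iᶜ => s((s : V), g s) := by
      ext e
      induction e using Sym2.ind with
      | _ u v =>
        rw [SimpleGraph.Subgraph.mem_edgeSet]
        constructor
        · rintro ⟨s, ⟨rfl, rfl⟩ | ⟨rfl, rfl⟩⟩
          exacts [⟨s, rfl⟩, ⟨s, Sym2.eq_swap⟩]
        · rintro ⟨s, h⟩
          rcases Sym2.eq_iff.1 h with ⟨rfl, rfl⟩ | ⟨rfl, rfl⟩
          exacts [⟨s, Or.inl ⟨rfl, rfl⟩⟩, ⟨s, Or.inr ⟨rfl, rfl⟩⟩]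
    rw [hrange]
    refine Nat.card_range_of_injective fun s t hst => Subtype.ext ?_
    rcases Sym2.eq_iff.1 hst with ⟨h, -⟩ | ⟨h, -⟩
    · exact h
    · exact absurd ((hadj t).1) (h ▸ s.2)

theorem matchingNum_eq_iff [Fintype V] (hI : ∀ u ∈ I, ∀ v ∈ I, ¬ G.Adj u v) :
    matchingNum G = Nat.card ↥Iᶜ ↔ SaturatesCompl G I := by
  have hub : Nat.card ↥Iᶜ ∈
      upperBounds {m | ∃ M : G.Subgraph, M.IsMatching ∧ M.edgeSet.ncard = m} := by
    rintro m ⟨M, hM, rfl⟩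
    exact ncard_edgeSet_le hI hM
  constructor
  · intro h
    have hne : {m | ∃ M : G.Subgraph, M.IsMatching ∧ M.edgeSet.ncard = m}.Nonempty :=
      ⟨_, ⊥, fun v hv => absurd hv (by simp), rfl⟩
    obtain ⟨M, hM, hcard⟩ := Nat.sSup_mem hne ⟨_, hub⟩
    exact saturatesCompl_of_isMatching hI hM (hcard.trans h)
  · intro hs
    exact IsGreatest.csSup_eq ⟨hs.exists_isMatching, hub⟩

end Matching

/-! ### Clique partitions -/

section CliquePartition

variable {V : Type*} {G : SimpleGraph V} {I : Set V}

/-- The map sending a vertex of `I` to its part in a partition into cliques is injective. -/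
theorem injective_part_of_isPartition (hI : ∀ u ∈ I, ∀ v ∈ I, ¬ G.Adj u v) {P : Set (Set V)}
    (hP : Setoid.IsPartition P) (hcl : ∀ s ∈ P, IsCliqueSet (toDigraph G) s) :
    ∃ part : I → P, Injective part ∧ ∀ i, (i : V) ∈ (part i : Set V) := by
  choose b hb using fun i : I => (hP.2 i).exists
  refine ⟨fun i => ⟨b i, (hb i).1⟩, fun i j hij => ?_, fun i => (hb i).2⟩
  by_contra hne
  have hbij : b i = b j := congrArg Subtype.val hij
  exact hI i i.2 j j.2
    (hcl _ (hb i).1 (hb i).2 (hbij ▸ (hb j).2) fun h => hne (Subtype.ext h))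

/-- In a clique partition with `|I|` parts each part meets `I`, and without triangles it contains at
most one further vertex. -/
theorem saturatesCompl_of_isPartition [Fintype V] (hG : G.CliqueFree 3)
    (hI : ∀ u ∈ I, ∀ v ∈ I, ¬ G.Adj u v)
    {P : Set (Set V)} (hP : Setoid.IsPartition P)
    (hcl : ∀ s ∈ P, IsCliqueSet (toDigraph G) s) (hcard : P.ncard = Nat.card I) :
    SaturatesCompl G I := by
  classical
  obtain ⟨part, hinj, hmem⟩ := injective_part_of_isPartition hI hP hcl
  have hsurj := (hinj.bijective_of_nat_card_le hcard.le).2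
  have hex : ∀ s : ↥Iᶜ, ∃ i : I, (s : V) ∈ (part i : Set V) := by
    intro s
    obtain ⟨b, hbP, hsb⟩ := (hP.2 s).exists
    obtain ⟨i, hi⟩ := hsurj ⟨b, hbP⟩
    exact ⟨i, by rwa [hi]⟩
  choose g hg using hex
  have hne : ∀ (s : ↥Iᶜ) (i : I), (s : V) ≠ i := fun s i h => s.2 (h ▸ i.2)
  have hadj : ∀ s : ↥Iᶜ, G.Adj s (g s) := fun s =>
    hcl _ (part (g s)).2 (hg s) (hmem (g s)) (hne s (g s))
  refine ⟨fun s => g s, fun s t hst => ?_, fun s => ⟨(g s).2, hadj s⟩⟩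
  have hst' : g s = g t := Subtype.ext hst
  by_contra hstne
  have hGst : G.Adj s t := hcl _ (part (g s)).2 (hg s) (hst' ▸ hg t) fun h => hstne (Subtype.ext h)
  exact hG {↑s, ↑t, ↑(g s)}
    (SimpleGraph.is3Clique_triple_iff.2 ⟨hGst, hadj s, hst' ▸ hadj t⟩)

/-- The parts are the vertices of `I`, each together with its partner if it has one. -/
theorem SaturatesCompl.exists_isPartition (hs : SaturatesCompl G I) :
    ∃ P : Set (Set V), Setoid.IsPartition P ∧ (∀ s ∈ P, IsCliqueSet (toDigraph G) s) ∧
      P.ncard = Nat.card I := by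
  classical
  obtain ⟨g, hg, hadj⟩ := hs
  let r : V → I := fun v => if hv : v ∈ I then ⟨v, hv⟩ else ⟨g ⟨v, hv⟩, (hadj ⟨v, hv⟩).1⟩
  have r1 : ∀ i : I, r i = i := fun i => dif_pos i.2
  have r2 : ∀ v (hv : v ∉ I), (r v : V) = g ⟨v, hv⟩ := fun v hv =>
    congrArg Subtype.val (dif_neg hv)
  have r1' : ∀ v, v ∈ I → (r v : V) = v := fun v hv => congrArg Subtype.val (r1 ⟨v, hv⟩)
  refine ⟨(Setoid.ker r).classes, Setoid.isPartition_classes _, ?_, ?_⟩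
  · rintro _ ⟨z, rfl⟩ u hu v hv huv
    have hr : (r u : V) = r v := congrArg Subtype.val
      ((show r u = r z from hu).trans (show r v = r z from hv).symm)
    change G.Adj u v
    by_cases hu : u ∈ I <;> by_cases hv : v ∈ I
    · rw [r1' u hu, r1' v hv] at hr
      exact absurd hr huv
    · rw [r1' u hu, r2 v hv] at hr
      exact hr ▸ (hadj ⟨v, hv⟩).2.symm
    · rw [r2 u hu, r1' v hv] at hr
      exact hr ▸ (hadj ⟨u, hu⟩).2
    · rw [r2 u hu, r2 v hv] at hr
      exact absurd (congrArg Subtype.val (hg hr)) huv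
  · have hrange : (Setoid.ker r).classes = Set.range fun i : I => {v | r v = i} := by
      ext b
      constructor
      · rintro ⟨z, rfl⟩
        exact ⟨r z, rfl⟩
      · rintro ⟨i, rfl⟩
        refine ⟨i, ?_⟩
        ext v
        change r v = i ↔ r v = r i
        rw [r1]
    rw [hrange]
    refine Nat.card_range_of_injective fun i j hij => ?_
    have : (i : V) ∈ {v | r v = j} := by
      rw [← hij]
      exact r1 i
    exact (r1 i).symm.trans this

theorem cliquePartitionNum_eq_iff [Fintype V] (hG : G.CliqueFree 3)
    (hI : ∀ u ∈ I, ∀ v ∈ I, ¬ G.Adj u v) :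
    cliquePartitionNum (toDigraph G) = Nat.card I ↔ SaturatesCompl G I := by
  constructor
  · intro h
    have hne : {m | ∃ P : Set (Set V), Setoid.IsPartition P ∧
        (∀ s ∈ P, IsCliqueSet (toDigraph G) s) ∧ P.ncard = m}.Nonempty := by
      refine ⟨_, (⊥ : Setoid V).classes, Setoid.isPartition_classes _, ?_, rfl⟩
      rintro _ ⟨z, rfl⟩ u hu v hv huv
      exact absurd ((show u = z from hu).trans (show v = z from hv).symm) huv
    obtain ⟨P, hP, hcl, hcard⟩ := Nat.sInf_mem hne
    exact saturatesCompl_of_isPartition hG hI hP hcl (hcard.trans h)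
  · intro hs
    refine IsLeast.csInf_eq ⟨hs.exists_isPartition, ?_⟩
    rintro m ⟨P, hP, hcl, rfl⟩
    obtain ⟨part, hinj, -⟩ := injective_part_of_isPartition hI hP hcl
    exact Nat.card_le_card_of_injective part hinj

end CliquePartition

/-! ### Linear solvability -/

section Linear

variable {V : Type*} {G : SimpleGraph V} {I : Set V}

theorem IsLinearCoding.numFix_pos [Fintype V] {R : Type*} [CommRing R] [Finite R]
    {f : (V → R) → (V → R)}
    (hf : IsLinearCoding f) : 0 < numFix f := by
  obtain ⟨a, ha⟩ := hf
  have : Nonempty (fixedPoints f) := ⟨⟨0, funext fun v => by simp [ha]⟩⟩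
  exact Nat.card_pos

theorem linear_numFix_mem_upperBounds [Fintype V] {q : ℕ} (hq : 2 ≤ q)
    (hI : ∀ u ∈ I, ∀ v ∈ I, ¬ G.Adj u v) :
    q ^ Nat.card ↥Iᶜ ∈ upperBounds {m : ℕ | ∃ (R : Type) (_ : CommRing R)
      (f : (V → R) → (V → R)), Nat.card R = q ∧ IsLinearCoding f ∧
        interactionGraph f ≤ toDigraph G ∧ numFix f = m} := by
  rintro m ⟨R, _, f, hR, -, hf, rfl⟩
  have : Finite R := Nat.finite_of_card_ne_zero (by omega)
  exact hR ▸ numFix_le hI hf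

/-- The maximum defining the linear guessing number is attained, so linear solvability gives an
actual linear coding function with the maximum number of fixed points. -/
theorem saturatesCompl_of_linearlySolvable [Fintype V] {q : ℕ} (hq : 2 ≤ q) (hG : G.CliqueFree 3)
    (hI : ∀ u ∈ I, ∀ v ∈ I, ¬ G.Adj u v) (hk : feedbackNum (toDigraph G) = Nat.card ↥Iᶜ)
    (h : LinearlySolvable (toDigraph G) q) : SaturatesCompl G I := by
  have : Fact (1 < q) := ⟨hq⟩
  have : NeZero q := ⟨by omega⟩
  have hne : {m : ℕ | ∃ (R : Type) (_ : CommRing R) (f : (V → R) → (V → R)),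
      Nat.card R = q ∧ IsLinearCoding f ∧ interactionGraph f ≤ toDigraph G ∧
        numFix f = m}.Nonempty :=
    ⟨_, ZMod q, inferInstance, copyCoding (fun _ => none) 0, Nat.card_zmod q,
      isLinearCoding_copyCoding _, interactionGraph_copyCoding_le (by simp) _, rfl⟩
  obtain ⟨R, _, f, hR, hlin, hf, hm⟩ := Nat.sSup_mem hne ⟨_, linear_numFix_mem_upperBounds hq hI⟩
  have : Finite R := Nat.finite_of_card_ne_zero (by omega)
  have : Nontrivial R := Finite.one_lt_card_iff_nontrivial.1 (by omega)
  have hlog : Real.logb q (numFix f : ℕ) = feedbackNum (toDigraph G) := by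
    rw [hm]
    exact h.1.trans h.2
  have hq1 : (1 : ℝ) < q := by exact_mod_cast hq
  rw [Real.logb_eq_iff_rpow_eq (by linarith) hq1.ne' (by exact_mod_cast hlin.numFix_pos),
    Real.rpow_natCast, hk] at hlog
  refine saturatesCompl_of_linear hG hI hlin hf ?_
  rw [hR]
  exact_mod_cast hlog.symm

theorem SaturatesCompl.hasLinearSolution [Fintype V] (hs : SaturatesCompl G I)
    (hI : ∀ u ∈ I, ∀ v ∈ I, ¬ G.Adj u v) (hk : feedbackNum (toDigraph G) = Nat.card ↥Iᶜ)
    (R : Type) [CommRing R] [Finite R] [Nontrivial R] : HasLinearSolution (toDigraph G) R := by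
  obtain ⟨h, hG, hfix⟩ := hs.exists_copyCoding hI
  exact ⟨copyCoding h 0, isLinearCoding_copyCoding h, interactionGraph_copyCoding_le hG 0,
    by rw [hfix, hk]⟩

theorem SaturatesCompl.solvableByRouting [Fintype V] (hs : SaturatesCompl G I)
    (hI : ∀ u ∈ I, ∀ v ∈ I, ¬ G.Adj u v) (hk : feedbackNum (toDigraph G) = Nat.card ↥Iᶜ)
    {q : ℕ} (hq : 2 ≤ q) : SolvableByRouting (toDigraph G) q := by
  have : Nontrivial (Fin q) := Fin.nontrivial_iff_two_le.2 hq
  obtain ⟨h, hG, hfix⟩ := hs.exists_copyCoding hI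
  exact ⟨copyCoding h ⟨0, by omega⟩, isRouting_copyCoding hG _, by rw [hfix, hk, Nat.card_fin]⟩

theorem SaturatesCompl.linearlySolvable [Fintype V] (hs : SaturatesCompl G I)
    (hI : ∀ u ∈ I, ∀ v ∈ I, ¬ G.Adj u v) (hk : feedbackNum (toDigraph G) = Nat.card ↥Iᶜ)
    {q : ℕ} (hq : 2 ≤ q) : LinearlySolvable (toDigraph G) q := by
  have : Fact (1 < q) := ⟨hq⟩
  have : NeZero q := ⟨by omega⟩
  have hq1 : (1 : ℝ) < q := by exact_mod_cast hq
  have hlog : Real.logb q ((q ^ Nat.card ↥Iᶜ : ℕ) : ℝ) = feedbackNum (toDigraph G) := by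
    rw [hk, Nat.cast_pow, Real.logb_pow, Real.logb_self_eq_one hq1, mul_one]
  obtain ⟨f, hlin, hf, hfix⟩ := hs.hasLinearSolution hI hk (ZMod q)
  obtain ⟨f', hf', hfix'⟩ := hs.solvableByRouting hI hk hq
  have h1 : linearGuessingNum (toDigraph G) q = feedbackNum (toDigraph G) := by
    rw [← hlog, linearGuessingNum, IsGreatest.csSup_eq ⟨?_, linear_numFix_mem_upperBounds hq hI⟩]
    exact ⟨ZMod q, inferInstance, f, Nat.card_zmod q, hlin, hf, by rw [hfix, hk, Nat.card_zmod]⟩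
  have h2 : guessingNum (toDigraph G) q = feedbackNum (toDigraph G) := by
    rw [← hlog, guessingNum, IsGreatest.csSup_eq (a := q ^ Nat.card ↥Iᶜ) ⟨?_, ?_⟩]
    · exact ⟨f', hf'.interactionGraph_le, by rw [hfix', hk]⟩
    · rintro m ⟨f, hf, rfl⟩
      simpa using numFix_le hI hf
  exact ⟨h1.trans h2.symm, h2⟩

end Linear

end NetworkCoding

theorem mainTheorem1 {V : Type*} [Fintype V] (G : SimpleGraph V) (hG : G.CliqueFree 3) :
    List.TFAE [
      -- linearly solvable over some alphabet, over all alphabets, and over every ring alphabet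
      ∃ q : ℕ, 2 ≤ q ∧ NetworkCoding.LinearlySolvable (NetworkCoding.toDigraph G) q,
      ∀ q : ℕ, 2 ≤ q → NetworkCoding.LinearlySolvable (NetworkCoding.toDigraph G) q,
      ∀ (R : Type) [CommRing R] [Finite R] [Nontrivial R],
        NetworkCoding.HasLinearSolution (NetworkCoding.toDigraph G) R,
      -- solvable by routing (over some alphabet, over all alphabets)
      ∃ q : ℕ, 2 ≤ q ∧ NetworkCoding.SolvableByRouting (NetworkCoding.toDigraph G) q,
      ∀ q : ℕ, 2 ≤ q → NetworkCoding.SolvableByRouting (NetworkCoding.toDigraph G) q,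
      NetworkCoding.VertexFull (NetworkCoding.toDigraph G),
      NetworkCoding.matchingNum G =
        NetworkCoding.feedbackNum (NetworkCoding.toDigraph G)] := by
  obtain ⟨I, hI, hk, hα⟩ := NetworkCoding.exists_maximum_independent G
  have hvf := NetworkCoding.cliquePartitionNum_eq_iff hG hI
  have hμ := NetworkCoding.matchingNum_eq_iff hI
  rw [NetworkCoding.VertexFull, hα]
  tfae_have 1 → 6 := fun ⟨q, hq, h⟩ =>
    hvf.2 (NetworkCoding.saturatesCompl_of_linearlySolvable hq hG hI hk h)
  tfae_have 3 → 6 := fun h => by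
    obtain ⟨f, hlin, hf, hfix⟩ := h (ZMod 2)
    exact hvf.2 (NetworkCoding.saturatesCompl_of_linear hG hI hlin hf (hk ▸ hfix))
  tfae_have 4 → 6 := fun ⟨q, hq, f, hf, hfix⟩ =>
    hvf.2 (NetworkCoding.saturatesCompl_of_routing hq hI hf (hk ▸ hfix))
  tfae_have 6 → 2 := fun h q hq => (hvf.1 h).linearlySolvable hI hk hq
  tfae_have 6 → 3 := fun h R _ _ _ => (hvf.1 h).hasLinearSolution hI hk R
  tfae_have 6 → 5 := fun h q hq => (hvf.1 h).solvableByRouting hI hk hq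
  tfae_have 2 → 1 := fun h => ⟨2, le_rfl, h 2 le_rfl⟩
  tfae_have 5 → 4 := fun h => ⟨2, le_rfl, h 2 le_rfl⟩
  tfae_have 6 ↔ 7 := by rw [hvf, hk, hμ]
  tfae_finish
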